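/- Let $A,B,C,D\in\mathbb R^{n\times n}$, let $M=\begin{bmatrix}C&D\\A&-B\end{bmatrix}$ and $\varphi(z)=M+zM^T$. Assume that $\varphi$ is regular (that is, $\det\varphi(z)\not\equiv0$), that $\det\varphi(z)\neq0$ whenever $|z|=1$, and that, for some $X,Y\in\mathbb C^{n\times n}$, the columns of $\begin{bmatrix}I\\X\end{bmatrix}$ and of $\begin{bmatrix}Y\\I\end{bmatrix}$ span deflating subspaces of $\varphi$ whose associated eigenvalues all lie inside the open unit disk and outside the closed unit disk ($\infty$ counts as outside), respectively. Here $\mathcal V$ is a deflating subspace of a pencil $K+zL$ if there is a subspace $\mathcal W$ with $\dim\mathcal W=\dim\mathcal V$, $K\mathcal V\subset\mathcal W$ and $L\mathcal V\subset\mathcal W$; writing $KV=WK'$ and $LV=WL'$, with bases of $\mathcal V$ and $\mathcal W$ as the columns of $V$ and $W$, its associated eigenvalues are those of the pencil $K'+zL'$. The finite eigenvalues of a regular pencil are the zeros of its determinant, and $\infty$ is an eigenvalue if the degree of the determinant is smaller than the size of the pencil. Assume that $S=\begin{bmatrix}C^T&D\\D^T&-B\end{bmatrix}$ is invertible, and let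 $E_0,F_0,G_0,P_0$ be defined by $$\begin{bmatrix}E_0&0\\-P_0&I\end{bmatrix}+z\begin{bmatrix}I&-G_0\\0&F_0\end{bmatrix}=S^{-1}(M+zM^T).$$ Assume that the doubling iteration $$E_{\ell+1}=E_\ell(I-G_\ell P_\ell)^{-1}E_\ell,\qquad P_{\ell+1}=P_\ell+F_\ell(I-P_\ell G_\ell)^{-1}P_\ell E_\ell,$$ $$F_{\ell+1}=F_\ell(I-P_\ell G_\ell)^{-1}F_\ell,\qquad G_{\ell+1}=G_\ell+E_\ell(I-G_\ell P_\ell)^{-1}G_\ell F_\ell$$ is well defined, i.e. $I-G_\ell P_\ell$ and $I-P_\ell G_\ell$ are invertible for every $\ell\ge0$. Then $X$ and $Y$ solve $$DX+X^TA-X^TBX+C=0\qquad\text{and}\qquad Y^TD+AY-B+Y^TCY=0,$$ respectively; the matrices $D^T-B^TX$ and $D+CY$ are invertible; the number $$\tau:=\rho\bigl((D^T-B^TX)^{-1}(A-BX)\bigr)=\rho\bigl((D+CY)^{-1}(A^T+C^TY)\bigr)$$ (the two spectral radii being equal) satisfies $\tau<1$; and for every matrix norm $$\limsup_{\ell\to\infty}\|P_\ell-X\|^{1/2^\ell}\le\tau^2,\qquad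 \limsup_{\ell\to\infty}\|G_\ell-Y\|^{1/2^\ell}\le\tau^2,$$ $$\limsup_{\ell\to\infty}\|E_\ell\|^{1/2^\ell}\le\tau,\qquad \limsup_{\ell\to\infty}\|F_\ell\|^{1/2^\ell}\le\tau.$$ -/

import Mathlib

open Matrix Filter
open scoped ENNReal Polynomial

namespace StarNARE

section Pencils

variable {m k : Type*} [Fintype m] [DecidableEq m] [Fintype k] [DecidableEq k]

/-- The polynomial `det (A + z B)` attached to the square matrix pencil `A + z B`. -/
noncomputable def pencilDet (A B : Matrix m m ℂ) : ℂ[X] :=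
  ((Polynomial.X : ℂ[X]) • B.map Polynomial.C + A.map Polynomial.C).det

/-- The pencil `A + z B` is regular: `det (A + z B)` is not identically zero. -/
def IsRegularPencil (A B : Matrix m m ℂ) : Prop := pencilDet A B ≠ 0

/-- Eigenvalues, in the extended complex plane, of a (regular) pencil `A + z B`: the finite ones
are the zeros of `det (A + z B)`, and infinity is an eigenvalue when the degree of
`det (A + z B)` is smaller than the size of the pencil. -/
def IsPencilEigenvalue (A B : Matrix m m ℂ) : OnePoint ℂ → Prop
  | some z => (pencilDet A B).IsRoot z
  | none => (pencilDet A B).natDegree < Fintype.card m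

/-- The subspace spanned by the columns of a matrix. -/
def columnSpan (V : Matrix m k ℂ) : Submodule ℂ (m → ℂ) :=
  Submodule.span ℂ (Set.range V.col)

/-- `𝒱` is a deflating subspace of the pencil `A + z B`: some subspace `𝒲` of the same dimension
contains both `A 𝒱` and `B 𝒱`. -/
def IsDeflatingSubspace (A B : Matrix m m ℂ) (𝒱 : Submodule ℂ (m → ℂ)) : Prop :=
  ∃ 𝒲 : Submodule ℂ (m → ℂ), Module.finrank ℂ 𝒲 = Module.finrank ℂ 𝒱 ∧
    𝒱.map A.mulVecLin ≤ 𝒲 ∧ 𝒱.map B.mulVecLin ≤ 𝒲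

/-- `μ` is an eigenvalue of `A + z B` associated with the deflating subspace `𝒱`: it is an
eigenvalue of a pencil `A' + z B'` such that `A V = W A'` and `B V = W B'`, where the columns of `V`
are a basis of `𝒱` and those of `W` are linearly independent. (For a regular pencil, changing the
bases replaces `A' + z B'` by an equivalent pencil, with the same eigenvalues.) -/
def IsAssociatedEigenvalue (A B : Matrix m m ℂ) (𝒱 : Submodule ℂ (m → ℂ))
    (μ : OnePoint ℂ) : Prop :=
  ∃ (d : ℕ) (V W : Matrix m (Fin d) ℂ) (A' B' : Matrix (Fin d) (Fin d) ℂ),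
    LinearIndependent ℂ V.col ∧ columnSpan V = 𝒱 ∧ LinearIndependent ℂ W.col ∧
      A * V = W * A' ∧ B * V = W * B' ∧ IsPencilEigenvalue A' B' μ

/-- The open unit disk, in the extended complex plane. -/
def insideDisk : Set (OnePoint ℂ) := {μ | ∃ z : ℂ, μ = (z : OnePoint ℂ) ∧ ‖z‖ < 1}

/-- The complement of the closed unit disk in the extended complex plane; it contains infinity. -/
def outsideDisk : Set (OnePoint ℂ) := {μ | ∀ z : ℂ, μ = (z : OnePoint ℂ) → 1 < ‖z‖}

end Pencils

section Riccati

variable {n : ℕ} {R : Type*} [CommRing R]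

/-- The coefficient matrix `M` of the palindromic pencil `M + z Mᵀ`. -/
def palM (A B C D : Matrix (Fin n) (Fin n) R) :
    Matrix (Fin n ⊕ Fin n) (Fin n ⊕ Fin n) R :=
  fromBlocks C D A (-B)

/-- The matrix `S`, by whose inverse the pencil `M + z Mᵀ` is multiplied. -/
def palS (B C D : Matrix (Fin n) (Fin n) R) :
    Matrix (Fin n ⊕ Fin n) (Fin n ⊕ Fin n) R :=
  fromBlocks Cᵀ D Dᵀ (-B)

/-- `X` solves the nonsymmetric `T`-Riccati equation with coefficients `A, B, C, D`. -/
def IsSolution (A B C D X : Matrix (Fin n) (Fin n) R) : Prop :=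
  D * X + Xᵀ * A - Xᵀ * B * X + C = 0

/-- `Y` solves the dual equation. -/
def IsDualSolution (A B C D Y : Matrix (Fin n) (Fin n) R) : Prop :=
  Yᵀ * D + A * Y - B + Yᵀ * C * Y = 0

/-- One quadruple of iterates of the doubling algorithm. -/
structure DoublingState (n : ℕ) (R : Type*) where
  E : Matrix (Fin n) (Fin n) R
  F : Matrix (Fin n) (Fin n) R
  G : Matrix (Fin n) (Fin n) R
  P : Matrix (Fin n) (Fin n) R

/-- The starting quadruple, read off the blocks of `S⁻¹ M = [E₀, 0; -P₀, I]` and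
`S⁻¹ Mᵀ = [I, -G₀; 0, F₀]`; see `inv_palS_mul_palM` and `inv_palS_mul_palM_transpose`. -/
noncomputable def doublingInit (A B C D : Matrix (Fin n) (Fin n) R) : DoublingState n R where
  E := ((palS B C D)⁻¹ * palM A B C D).toBlocks₁₁
  F := ((palS B C D)⁻¹ * (palM A B C D)ᵀ).toBlocks₂₂
  G := -((palS B C D)⁻¹ * (palM A B C D)ᵀ).toBlocks₁₂
  P := -((palS B C D)⁻¹ * palM A B C D).toBlocks₂₁

/-- One step of the doubling algorithm. -/
noncomputable def doublingStep (s : DoublingState n R) : DoublingState n R where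
  E := s.E * (1 - s.G * s.P)⁻¹ * s.E
  F := s.F * (1 - s.P * s.G)⁻¹ * s.F
  G := s.G + s.E * (1 - s.G * s.P)⁻¹ * s.G * s.F
  P := s.P + s.F * (1 - s.P * s.G)⁻¹ * s.P * s.E

/-- The doubling iteration. -/
noncomputable def doubling (A B C D : Matrix (Fin n) (Fin n) R) : ℕ → DoublingState n R
  | 0 => doublingInit A B C D
  | l + 1 => doublingStep (doubling A B C D l)

/-- The doubling iteration is well defined: every matrix that it inverts is invertible. -/
def DoublingWellDefined (A B C D : Matrix (Fin n) (Fin n) R) : Prop :=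
  IsUnit (palS B C D) ∧
    ∀ l : ℕ,
      IsUnit (1 - (doubling A B C D l).G * (doubling A B C D l).P) ∧
        IsUnit (1 - (doubling A B C D l).P * (doubling A B C D l).G)

theorem inv_palS_mul_palM (A B C D : Matrix (Fin n) (Fin n) R) (h : IsUnit (palS B C D)) :
    (palS B C D)⁻¹ * palM A B C D =
      fromBlocks (doublingInit A B C D).E 0 (-(doublingInit A B C D).P) 1 := by
  have h1 : (palS B C D)⁻¹ * palS B C D = 1 :=
    nonsing_inv_mul _ ((isUnit_iff_isUnit_det _).mp h)
  have h2 : ∀ i j, ((palS B C D)⁻¹ * palM A B C D) i (Sum.inr j) =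
      ((palS B C D)⁻¹ * palS B C D) i (Sum.inr j) := by
    intro i j
    simp [Matrix.mul_apply, palM, palS]
  ext (i | i) (j | j)
  · simp [doublingInit, toBlocks₁₁]
  · rw [h2, h1]; simp
  · simp [doublingInit, toBlocks₂₁]
  · rw [h2, h1]; simp [Matrix.one_apply]

theorem inv_palS_mul_palM_transpose (A B C D : Matrix (Fin n) (Fin n) R)
    (h : IsUnit (palS B C D)) :
    (palS B C D)⁻¹ * (palM A B C D)ᵀ =
      fromBlocks 1 (-(doublingInit A B C D).G) 0 (doublingInit A B C D).F := by
  have h1 : (palS B C D)⁻¹ * palS B C D = 1 :=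
    nonsing_inv_mul _ ((isUnit_iff_isUnit_det _).mp h)
  have h2 : ∀ i j, ((palS B C D)⁻¹ * (palM A B C D)ᵀ) i (Sum.inl j) =
      ((palS B C D)⁻¹ * palS B C D) i (Sum.inl j) := by
    intro i j
    simp [Matrix.mul_apply, palM, palS]
  ext (i | i) (j | j)
  · rw [h2, h1]; simp [Matrix.one_apply]
  · simp [doublingInit, toBlocks₁₂]
  · rw [h2, h1]; simp
  · simp [doublingInit, toBlocks₂₂]

end Riccati

/-- A real matrix regarded as a complex one. -/
noncomputable def toC {m k : Type*} (A : Matrix m k ℝ) : Matrix m k ℂ :=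
  A.map (algebraMap ℝ ℂ)

/-- `limsup ‖Z l‖ ^ (1 / 2 ^ l)` as `l → ∞`, taken in `[0, ∞]`. -/
noncomputable def doublingRate {n : ℕ} (ν : Seminorm ℝ (Matrix (Fin n) (Fin n) ℂ))
    (Z : ℕ → Matrix (Fin n) (Fin n) ℂ) : ℝ≥0∞ :=
  limsup (fun l : ℕ => ENNReal.ofReal (ν (Z l)) ^ ((1 : ℝ) / 2 ^ l)) atTop

end StarNARE

open StarNARE

/-! Put U = [I; X] and V = [Y; I]. The location of the associated eigenvalues turns deflation into
MU = MᵀUL and MᵀV = MVK, with ρ(L), ρ(K) < 1.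

Palindromicity makes N = UᵀMU satisfy N = LᵀNL, so N = 0, which is the Riccati equation; V is
treated alike (`transpose_mul_mul_eq_zero_of_stable`).

Each doubling step preserves E = (1 - GX)L^(2^l) and X - P = FXL^(2^l), together with the dual pair
F = (1 - PY)K^(2^l) and Y - G = EYK^(2^l) (`doubling_relations`, `doubling_dual_relations`).
Eliminating G bounds E by a multiple of ‖L^(2^l)‖, hence G - Y by a multiple of ‖L^(2^l)‖‖K^(2^l)‖;
Gelfand's formula gives the rates (`doubling_rates`).

Finally H = UᵀMV satisfies HK = LᵀH and equals (1 - YX)ᵀ(D + CY). It is invertible because the two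
graphs meet trivially (`isUnit_one_sub_mul_of_stable`), so ρ(L) = ρ(K). -/

namespace StarNARE

/-! ### Ring identities behind one doubling step -/

section DoublingAlgebra

variable {α : Type*} [Ring α] {E F G P X L J : α}

/-- Stated in an abstract ring so that the dual relations follow by exchanging E with F, G with P, X
with Y and L with K. -/
theorem doubling_diag_step (hE : E = (1 - G * X) * L) (hP : X - P = F * X * L)
    (hJ : J * (1 - G * P) = 1) :
    E * J * E = (1 - (G + E * J * G * F) * X) * (L * L) := by
  linear_combination (norm := noncomm_ring) E * J * hE + hE * L - E * J * G * hP * L + E * hJ * L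

theorem doubling_offdiag_step (hE : E = (1 - G * X) * L) (hP : X - P = F * X * L)
    (hJ : J * (1 - P * G) = 1) :
    X - (P + F * J * P * E) = F * J * F * X * (L * L) := by
  linear_combination (norm := noncomm_ring) hP - F * J * P * hE + F * J * hP * L - F * hJ * X * L

end DoublingAlgebra

/-! ### Spectral radii and convergence rates -/

section Rates

open scoped Matrix.Norms.Operator Topology

variable {n : ℕ}

theorem exists_seminorm_le_mul_norm (ν : Seminorm ℝ (Matrix (Fin n) (Fin n) ℂ)) :
    ∃ c : ℝ, 0 < c ∧ ∀ Z, ν Z ≤ c * ‖Z‖ := by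
  have h : ContinuousOn ν (interior Set.univ) := ν.convexOn.continuousOn_interior
  rw [interior_univ, continuousOn_univ] at h
  exact ν.bound_of_continuous_normedSpace h

/-- Constant factors are invisible to the rate, since c^(1/2^l) tends to 1 for c > 0; this is also
why the choice of norm does not matter. -/
theorem doublingRate_le_of_norm_le (ν : Seminorm ℝ (Matrix (Fin n) (Fin n) ℂ))
    {Z : ℕ → Matrix (Fin n) (Fin n) ℂ} {u : ℕ → ℝ} {c : ℝ} {ρ : ℝ≥0∞} (hu : ∀ l, 0 ≤ u l)
    (hZ : ∀ᶠ l in atTop, ‖Z l‖ ≤ c * u l)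
    (hρ : Tendsto (fun l : ℕ => ENNReal.ofReal (u l) ^ ((1 : ℝ) / 2 ^ l)) atTop (𝓝 ρ)) :
    doublingRate ν Z ≤ ρ := by
  obtain ⟨C, hC, hν⟩ := exists_seminorm_le_mul_norm ν
  -- The added 1 keeps the constant positive, even when c = 0.
  have hK : 0 < C * |c| + 1 := by positivity
  have hexp : Tendsto (fun l : ℕ => (1 : ℝ) / 2 ^ l) atTop (𝓝 0) := by
    simpa using tendsto_pow_atTop_nhds_zero_of_lt_one (r := (1 / 2 : ℝ)) (by norm_num) (by norm_num)
  have h1 : Tendsto (fun l : ℕ => ENNReal.ofReal (C * |c| + 1) ^ ((1 : ℝ) / 2 ^ l)) atTop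
      (𝓝 1) := by
    have h := ENNReal.tendsto_ofReal
      (((Real.continuousAt_const_rpow hK.ne').tendsto (x := (0 : ℝ))).comp hexp)
    simpa [ENNReal.ofReal_rpow_of_pos hK, Function.comp_def] using h
  have h2 := ENNReal.Tendsto.mul h1 (Or.inl one_ne_zero) hρ (Or.inr ENNReal.one_ne_top)
  rw [one_mul] at h2
  rw [doublingRate, ← h2.limsup_eq]
  refine limsup_le_limsup ?_
  filter_upwards [hZ] with l hl
  rw [← ENNReal.mul_rpow_of_nonneg _ _ (by positivity), ← ENNReal.ofReal_mul hK.le]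
  refine ENNReal.rpow_le_rpow (ENNReal.ofReal_le_ofReal ?_) (by positivity)
  calc ν (Z l) ≤ C * ‖Z l‖ := hν _
    _ ≤ C * (|c| * u l) := by
        gcongr
        exact hl.trans (mul_le_mul_of_nonneg_right (le_abs_self c) (hu l))
    _ ≤ (C * |c| + 1) * u l := by nlinarith [hu l]

theorem tendsto_norm_pow_two_pow_rpow (L : Matrix (Fin n) (Fin n) ℂ) :
    Tendsto (fun l : ℕ => ENNReal.ofReal ‖L ^ 2 ^ l‖ ^ ((1 : ℝ) / 2 ^ l)) atTop
      (𝓝 (spectralRadius ℂ L)) := by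
  have h := (spectrum.pow_nnnorm_pow_one_div_tendsto_nhds_spectralRadius L).comp
    (tendsto_pow_atTop_atTop_of_one_lt (r := 2) one_lt_two)
  refine h.congr fun l => ?_
  simp [ENNReal.ofReal, norm_toNNReal]

theorem tendsto_pow_zero_of_spectralRadius_lt_one {L : Matrix (Fin n) (Fin n) ℂ}
    (hL : spectralRadius ℂ L < 1) : Tendsto (fun k : ℕ => L ^ k) atTop (𝓝 0) := by
  obtain ⟨r, hLr, hr⟩ := ENNReal.lt_iff_exists_nnreal_btwn.mp hL
  have hr1 : (r : ℝ) < 1 := by exact_mod_cast hr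
  refine squeeze_zero_norm' ?_ (tendsto_pow_atTop_nhds_zero_of_lt_one r.coe_nonneg hr1)
  filter_upwards [(spectrum.pow_nnnorm_pow_one_div_tendsto_nhds_spectralRadius L).eventually
    (gt_mem_nhds hLr), eventually_gt_atTop 0] with k hk hk0
  have h := ENNReal.rpow_le_rpow hk.le (Nat.cast_nonneg (α := ℝ) k)
  rw [← ENNReal.rpow_mul, one_div_mul_cancel (by positivity), ENNReal.rpow_one,
    ENNReal.rpow_natCast] at h
  exact_mod_cast h

theorem spectralRadius_lt_one_of_forall_norm_lt {L : Matrix (Fin n) (Fin n) ℂ}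
    (h : ∀ μ ∈ spectrum ℂ L, ‖μ‖ < 1) : spectralRadius ℂ L < 1 := by
  rcases (spectrum ℂ L).eq_empty_or_nonempty with h0 | h0
  · simp [spectralRadius, h0]
  · exact_mod_cast spectrum.spectralRadius_lt_of_forall_lt_of_nonempty h0 (r := 1)
      fun k hk => by exact_mod_cast h k hk

theorem norm_lt_one_of_mem_spectrum {L : Matrix (Fin n) (Fin n) ℂ} (hL : spectralRadius ℂ L < 1)
    {μ : ℂ} (hμ : μ ∈ spectrum ℂ L) : ‖μ‖ < 1 := by
  have h : (‖μ‖₊ : ℝ≥0∞) < 1 := lt_of_le_of_lt (le_iSup₂ (α := ℝ≥0∞) μ hμ) hL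
  exact_mod_cast h

/-- Iteration gives N = K^k N L^k for every k, and both powers tend to zero. -/
theorem eq_zero_of_stein {N K L : Matrix (Fin n) (Fin n) ℂ} (hK : spectralRadius ℂ K < 1)
    (hL : spectralRadius ℂ L < 1) (h : N = K * N * L) : N = 0 := by
  have hk : ∀ k : ℕ, N = K ^ k * N * L ^ k := by
    intro k
    induction k with
    | zero => simp
    | succ k ih =>
      calc N = K ^ k * N * L ^ k := ih
        _ = K ^ k * (K * N * L) * L ^ k := by rw [← h]
        _ = K ^ (k + 1) * N * L ^ (k + 1) := by rw [pow_succ, pow_succ' L]; noncomm_ring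
  have hlim : Tendsto (fun k : ℕ => K ^ k * N * L ^ k) atTop (𝓝 (0 * N * 0)) :=
    ((tendsto_pow_zero_of_spectralRadius_lt_one hK).mul_const N).mul
      (tendsto_pow_zero_of_spectralRadius_lt_one hL)
  have := tendsto_nhds_unique (tendsto_const_nhds.congr hk) hlim
  simpa using this

theorem spectrum_matrix_transpose (L : Matrix (Fin n) (Fin n) ℂ) :
    spectrum ℂ Lᵀ = spectrum ℂ L := by
  ext μ
  have : algebraMap ℂ (Matrix (Fin n) (Fin n) ℂ) μ - Lᵀ = (algebraMap ℂ _ μ - L)ᵀ := by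
    simp [Matrix.algebraMap_eq_diagonal]
  rw [spectrum.mem_iff, spectrum.mem_iff, this, isUnit_transpose]

/-- If `E (1 - T) = H L` with `T` tending to zero, then `E` is of the order of `L`. -/
theorem eventually_norm_le_of_mul_one_sub {E T L : ℕ → Matrix (Fin n) (Fin n) ℂ}
    {H : Matrix (Fin n) (Fin n) ℂ} (hT : Tendsto T atTop (𝓝 0))
    (h : ∀ l, E l * (1 - T l) = H * L l) : ∀ᶠ l in atTop, ‖E l‖ ≤ 2 * ‖H‖ * ‖L l‖ := by
  have hT' : Tendsto (fun l => ‖T l‖) atTop (𝓝 0) := by simpa using hT.norm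
  filter_upwards [hT'.eventually (gt_mem_nhds (show (0 : ℝ) < 1 / 2 by norm_num))] with l hl
  have h1 : E l = H * L l + E l * T l := by rw [← h l]; noncomm_ring
  have h2 : ‖E l‖ ≤ ‖H‖ * ‖L l‖ + ‖E l‖ * ‖T l‖ := by
    calc ‖E l‖ = ‖H * L l + E l * T l‖ := by rw [← h1]
      _ ≤ ‖H * L l‖ + ‖E l * T l‖ := norm_add_le _ _
      _ ≤ _ := add_le_add (norm_mul_le _ _) (norm_mul_le _ _)
  nlinarith [norm_nonneg (E l)]

/-- Convergence of sequences satisfying the relations preserved by the doubling algorithm. -/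
theorem doubling_rates {E G : ℕ → Matrix (Fin n) (Fin n) ℂ}
    {X Y K L : Matrix (Fin n) (Fin n) ℂ}
    (hK : spectralRadius ℂ K < 1) (hL : spectralRadius ℂ L < 1)
    (hE : ∀ l, E l = (1 - G l * X) * L ^ 2 ^ l) (hG : ∀ l, Y - G l = E l * Y * K ^ 2 ^ l)
    (ν : Seminorm ℝ (Matrix (Fin n) (Fin n) ℂ)) :
    doublingRate ν E ≤ spectralRadius ℂ L ∧
      doublingRate ν (fun l => G l - Y) ≤ spectralRadius ℂ L * spectralRadius ℂ K := by
  have hpow : Tendsto (fun l : ℕ => 2 ^ l) atTop atTop :=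
    tendsto_pow_atTop_atTop_of_one_lt (r := 2) one_lt_two
  have hK0 := (tendsto_pow_zero_of_spectralRadius_lt_one hK).comp hpow
  have hL0 := (tendsto_pow_zero_of_spectralRadius_lt_one hL).comp hpow
  have hT : Tendsto (fun l : ℕ => Y * K ^ 2 ^ l * X * L ^ 2 ^ l) atTop (𝓝 0) := by
    simpa using ((hK0.const_mul Y).mul_const X).mul hL0
  -- Substituting G = Y - EYK^(2^l) into the relation for E leaves E as the only unknown.
  have hEb := eventually_norm_le_of_mul_one_sub (E := E) (H := 1 - Y * X) (L := fun l => L ^ 2 ^ l) hT fun l => by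
    linear_combination (norm := noncomm_ring) hE l + hG l * X * L ^ 2 ^ l
  have hEr := tendsto_norm_pow_two_pow_rpow L
  have hKr := tendsto_norm_pow_two_pow_rpow K
  refine ⟨doublingRate_le_of_norm_le ν (fun l => norm_nonneg _) hEb hEr,
    doublingRate_le_of_norm_le ν (c := 2 * ‖1 - Y * X‖ * ‖Y‖)
      (u := fun l => ‖L ^ 2 ^ l‖ * ‖K ^ 2 ^ l‖) (fun l => by positivity) ?_ ?_⟩
  · filter_upwards [hEb] with l hl
    rw [← norm_neg, neg_sub, hG l]
    calc ‖E l * Y * K ^ 2 ^ l‖ ≤ ‖E l‖ * ‖Y‖ * ‖K ^ 2 ^ l‖ :=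
          (norm_mul_le _ _).trans (by gcongr; exact norm_mul_le _ _)
      _ ≤ (2 * ‖1 - Y * X‖ * ‖L ^ 2 ^ l‖) * ‖Y‖ * ‖K ^ 2 ^ l‖ := by gcongr
      _ = _ := by ring
  · have := ENNReal.Tendsto.mul hEr (Or.inr (hK.trans_le le_top).ne) hKr
      (Or.inr (hL.trans_le le_top).ne)
    refine this.congr fun l => ?_
    rw [ENNReal.ofReal_mul (norm_nonneg _), ENNReal.mul_rpow_of_nonneg _ _ (by positivity)]

end Rates

end StarNARE

namespace StarNARE

/-! ### From deflating subspaces to stable matrices -/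

section Deflating

variable {m : Type*} [Fintype m] {n : ℕ}

theorem IsDeflatingSubspace.exists_reduction {K L : Matrix m m ℂ} {V : Matrix m (Fin n) ℂ}
    (hV : LinearIndependent ℂ V.col) (h : IsDeflatingSubspace K L (columnSpan V)) :
    ∃ (W : Matrix m (Fin n) ℂ) (K' L' : Matrix (Fin n) (Fin n) ℂ),
      LinearIndependent ℂ W.col ∧ K * V = W * K' ∧ L * V = W * L' := by
  obtain ⟨𝒲, hdim, hK, hL⟩ := h
  have hfin : Module.finrank ℂ 𝒲 = n := by
    rw [hdim, columnSpan, finrank_span_eq_card hV, Fintype.card_fin]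
  let w : Module.Basis (Fin n) ℂ 𝒲 := Module.finBasisOfFinrankEq ℂ 𝒲 hfin
  have hmem : ∀ j, V.col j ∈ columnSpan V := fun j => Submodule.subset_span ⟨j, rfl⟩
  have key : ∀ T : Matrix m m ℂ, (columnSpan V).map T.mulVecLin ≤ 𝒲 →
      ∃ T' : Matrix (Fin n) (Fin n) ℂ,
        T * V = (Matrix.of fun i j => (w j : m → ℂ) i) * T' := by
    intro T hT
    have hTm : ∀ j, T *ᵥ V.col j ∈ 𝒲 := fun j => hT ⟨V.col j, hmem j, rfl⟩
    refine ⟨Matrix.of fun i j => w.repr ⟨_, hTm j⟩ i, ?_⟩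
    ext i j
    have h1 := congrArg (fun x : 𝒲 => (x : m → ℂ) i) (w.sum_repr ⟨_, hTm j⟩)
    simp only [AddSubmonoidClass.coe_finsetSum, Finset.sum_apply, Submodule.coe_smul,
      Pi.smul_apply, smul_eq_mul] at h1
    simp only [Matrix.mul_apply, of_apply]
    simp only [mulVec, dotProduct, col_apply] at h1
    rw [← h1]
    exact Finset.sum_congr rfl fun k _ => mul_comm _ _
  obtain ⟨K', hK'⟩ := key K hK
  obtain ⟨L', hL'⟩ := key L hL
  refine ⟨_, K', L', ?_, hK', hL'⟩
  exact w.linearIndependent.map' 𝒲.subtype 𝒲.ker_subtype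

theorem eval_pencilDet [DecidableEq m] (A B : Matrix m m ℂ) (z : ℂ) :
    (pencilDet A B).eval z = (A + z • B).det := by
  rw [pencilDet, ← Polynomial.coe_evalRingHom, RingHom.map_det]
  congr 1
  ext i j
  simp [add_comm, mul_comm z]

theorem det_ne_zero_of_not_isPencilEigenvalue_infty [DecidableEq m] {A B : Matrix m m ℂ}
    (h : ¬ IsPencilEigenvalue A B OnePoint.infty) : B.det ≠ 0 := by
  intro h0
  have hlt : ¬ (pencilDet A B).natDegree < Fintype.card m := h
  have hc : (pencilDet A B).coeff (Fintype.card m) = 0 := by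
    rw [← h0]; exact Polynomial.coeff_det_X_add_C_card B A
  have hle : (pencilDet A B).natDegree ≤ Fintype.card m := Polynomial.natDegree_det_X_add_C_le B A
  have heq : (pencilDet A B).natDegree = Fintype.card m := le_antisymm hle (not_lt.mp hlt)
  have hp : pencilDet A B = 0 := by
    rwa [← heq, ← Polynomial.leadingCoeff, Polynomial.leadingCoeff_eq_zero] at hc
  rw [hp, Polynomial.natDegree_zero] at heq
  -- The zero polynomial has `natDegree` 0, which forces size 0; but the empty determinant is 1.
  have : IsEmpty m := Fintype.card_eq_zero_iff.mp heq.symm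
  simp at h0

/-- A reduced pencil `K' + z L'` with `L'` invertible becomes a matrix `L'⁻¹ K'`. -/
theorem exists_stable_of_reduction {K L : Matrix m m ℂ} {V W : Matrix m (Fin n) ℂ}
    {K' L' : Matrix (Fin n) (Fin n) ℂ} (hW : LinearIndependent ℂ W.col) (hK : K * V = W * K')
    (hL : L * V = W * L') (hdet : L'.det ≠ 0)
    (h : ∀ μ : ℂ, (μ • L' - K').det = 0 → ‖μ‖ < 1) :
    ∃ T : Matrix (Fin n) (Fin n) ℂ, spectralRadius ℂ T < 1 ∧ K * V = L * V * T ∧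
      Function.Injective (L * V).mulVec := by
  have hu : IsUnit L'.det := isUnit_iff_ne_zero.mpr hdet
  refine ⟨L'⁻¹ * K', spectralRadius_lt_one_of_forall_norm_lt fun μ hμ => h μ ?_, ?_, ?_⟩
  · rw [spectrum.mem_iff, isUnit_iff_isUnit_det, isUnit_iff_ne_zero, not_not,
      Algebra.algebraMap_eq_smul_one] at hμ
    have : μ • L' - K' = L' * (μ • 1 - L'⁻¹ * K') := by
      rw [mul_sub, mul_nonsing_inv_cancel_left _ _ hu, mul_smul_comm, mul_one]
    rw [this, det_mul, hμ, mul_zero]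
  · rw [hL, hK, Matrix.mul_assoc, mul_nonsing_inv_cancel_left _ _ hu]
  · rw [hL]
    have h1 := (mulVec_injective_iff.mpr hW).comp
      (mulVec_injective_iff_isUnit.mpr ((isUnit_iff_isUnit_det _).mpr hu))
    simpa [Function.comp_def, mulVec_mulVec] using h1

theorem IsDeflatingSubspace.exists_stable_of_inside {K L : Matrix m m ℂ}
    {V : Matrix m (Fin n) ℂ} (hV : LinearIndependent ℂ V.col)
    (h : IsDeflatingSubspace K L (columnSpan V))
    (heig : ∀ μ, IsAssociatedEigenvalue K L (columnSpan V) μ → μ ∈ insideDisk) :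
    ∃ T : Matrix (Fin n) (Fin n) ℂ, spectralRadius ℂ T < 1 ∧ K * V = L * V * T ∧
      Function.Injective (L * V).mulVec := by
  obtain ⟨W, K', L', hW, hK, hL⟩ := h.exists_reduction hV
  have hass : ∀ μ, IsPencilEigenvalue K' L' μ → μ ∈ insideDisk := fun μ hμ =>
    heig μ ⟨n, V, W, K', L', hV, rfl, hW, hK, hL, hμ⟩
  refine exists_stable_of_reduction hW hK hL ?_ fun μ hμ => ?_
  · refine det_ne_zero_of_not_isPencilEigenvalue_infty (A := K') fun hinf => ?_
    obtain ⟨z, hz, -⟩ := hass _ hinf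
    exact OnePoint.infty_ne_coe z hz
  -- Eigenvalues of K' + zL' are the negatives of those of L'⁻¹K'; only the modulus matters.
  · have h0 : IsPencilEigenvalue K' L' ((-μ : ℂ) : OnePoint ℂ) := by
      change (pencilDet K' L').eval (-μ) = 0
      have : K' + (-μ) • L' = -(μ • L' - K') := by rw [neg_smul]; abel
      rw [eval_pencilDet, this, det_neg, hμ, mul_zero]
    obtain ⟨z, hz, hz1⟩ := hass _ h0
    rw [← OnePoint.coe_injective hz, norm_neg] at hz1
    exact hz1

theorem IsDeflatingSubspace.exists_stable_of_outside {K L : Matrix m m ℂ}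
    {V : Matrix m (Fin n) ℂ} (hV : LinearIndependent ℂ V.col)
    (h : IsDeflatingSubspace K L (columnSpan V))
    (heig : ∀ μ, IsAssociatedEigenvalue K L (columnSpan V) μ → μ ∈ outsideDisk) :
    ∃ T : Matrix (Fin n) (Fin n) ℂ, spectralRadius ℂ T < 1 ∧ L * V = K * V * T ∧
      Function.Injective (K * V).mulVec := by
  obtain ⟨W, K', L', hW, hK, hL⟩ := h.exists_reduction hV
  have hroot : ∀ z : ℂ, (K' + z • L').det = 0 → 1 < ‖z‖ := fun z hz =>
    heig (z : OnePoint ℂ) ⟨n, V, W, K', L', hV, rfl, hW, hK, hL, by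
      change (pencilDet K' L').eval z = 0
      rw [eval_pencilDet, hz]⟩ z rfl
  refine exists_stable_of_reduction hW hL hK (fun h0 => ?_) fun μ hμ => ?_
  · have := hroot 0 (by simpa using h0)
    norm_num at this
  -- Here μ corresponds to the pencil eigenvalue -1/μ, so μ = 0 is the eigenvalue at infinity.
  · by_cases hμ0 : μ = 0
    · simp [hμ0]
    have h1 : K' + (-μ⁻¹) • L' = μ⁻¹ • (μ • K' - L') := by
      rw [smul_sub, smul_smul, inv_mul_cancel₀ hμ0, one_smul, neg_smul, sub_eq_add_neg]
    have h2 := hroot (-μ⁻¹) (by rw [h1, det_smul, hμ, mul_zero])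
    rw [norm_neg, norm_inv] at h2
    exact (one_lt_inv₀ (norm_pos_iff.mpr hμ0)).mp h2

/-- A stable deflating subspace of a palindromic pencil is isotropic. -/
theorem transpose_mul_mul_eq_zero_of_stable {M : Matrix m m ℂ} {U : Matrix m (Fin n) ℂ}
    {T : Matrix (Fin n) (Fin n) ℂ} (hT : spectralRadius ℂ T < 1) (h : M * U = Mᵀ * U * T) :
    Uᵀ * (M * U) = 0 := by
  -- N = UᵀMU satisfies N = NᵀT; transposing and substituting back gives the Stein equation N =
  -- TᵀNT.
  have h1 : Uᵀ * (M * U) = (Uᵀ * (M * U))ᵀ * T := by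
    conv_lhs => rw [h]
    simp only [transpose_mul, transpose_transpose, Matrix.mul_assoc]
  have h2 : (Uᵀ * (M * U))ᵀ = Tᵀ * (Uᵀ * (M * U)) := by
    conv_lhs => rw [h1]
    rw [transpose_mul, transpose_transpose]
  refine eq_zero_of_stein (K := Tᵀ) (L := T) ?_ hT (h1.trans (by rw [h2]))
  rwa [spectralRadius, spectrum_matrix_transpose]

end Deflating

/-! ### Trivial intersection of the two graph subspaces -/

section Radii

variable {n : ℕ}

theorem isUnit_one_add_of_stable {T : Matrix (Fin n) (Fin n) ℂ} (hT : spectralRadius ℂ T < 1) :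
    IsUnit (1 + T) := by
  by_contra h
  have : (-1 : ℂ) ∈ spectrum ℂ T := by
    rw [spectrum.mem_iff, map_neg, map_one]
    have e : -1 - T = -(1 + T) := by abel
    rwa [e, IsUnit.neg_iff]
  simpa using norm_lt_one_of_mem_spectrum hT this

theorem exists_eigenvector_of_invariant {N P : Matrix (Fin n) (Fin n) ℂ}
    (hinv : ∀ a, N *ᵥ a = 0 → N *ᵥ (P *ᵥ a) = 0) (hN : ¬ IsUnit N) :
    ∃ (p : ℂ) (a : Fin n → ℂ), a ≠ 0 ∧ N *ᵥ a = 0 ∧ P *ᵥ a = p • a := by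
  have hker : LinearMap.ker N.mulVecLin ≠ ⊥ := fun h =>
    hN (mulVec_injective_iff_isUnit.mp (LinearMap.ker_eq_bot.mp h))
  have : Nontrivial (LinearMap.ker N.mulVecLin) := Submodule.nontrivial_iff_ne_bot.mpr hker
  let f : Module.End ℂ (LinearMap.ker N.mulVecLin) :=
    P.mulVecLin.restrict fun a ha => hinv a ha
  obtain ⟨p, hp⟩ := Module.End.exists_eigenvalue f
  obtain ⟨v, hv⟩ := hp.exists_hasEigenvector
  refine ⟨p, v, fun h => hv.2 (Subtype.ext h), v.2, ?_⟩
  exact congrArg Subtype.val hv.apply_eq_smul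

/-- The graph subspaces spanned by `[I; X]` and `[Y; I]` meet trivially when they carry the
eigenvalues of the pencil inside and outside the disk, respectively. -/
theorem isUnit_one_sub_mul_of_stable {K L : Matrix (Fin n ⊕ Fin n) (Fin n ⊕ Fin n) ℂ}
    {X Y S T : Matrix (Fin n) (Fin n) ℂ} (hreg : IsUnit (K + L))
    (hS : spectralRadius ℂ S < 1) (hT : spectralRadius ℂ T < 1)
    (hX : K * fromRows (1 : Matrix (Fin n) (Fin n) ℂ) X = L * fromRows (1 : Matrix (Fin n) (Fin n) ℂ) X * S)
    (hY : L * fromRows Y (1 : Matrix (Fin n) (Fin n) ℂ) = K * fromRows Y (1 : Matrix (Fin n) (Fin n) ℂ) * T) : IsUnit (1 - Y * X) := by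
  have hKL := (isUnit_iff_isUnit_det _).mp hreg
  have hS1 := (isUnit_iff_isUnit_det _).mp (isUnit_one_add_of_stable hS)
  have hT1 := (isUnit_iff_isUnit_det _).mp (isUnit_one_add_of_stable hT)
  -- (K + L)⁻¹L leaves both graphs invariant, acting as (1 + S)⁻¹ on one and (1 + T)⁻¹T on the
  -- other. It thus preserves their intersection, parametrized by ker(1 - YX).
  have h1 : (K + L)⁻¹ * L * fromRows (1 : Matrix (Fin n) (Fin n) ℂ) X = fromRows (1 : Matrix (Fin n) (Fin n) ℂ) X * (1 + S)⁻¹ := by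
    have : L * fromRows (1 : Matrix (Fin n) (Fin n) ℂ) X * (1 + S) = (K + L) * fromRows (1 : Matrix (Fin n) (Fin n) ℂ) X := by
      rw [Matrix.mul_add, Matrix.mul_one, ← hX, Matrix.add_mul, add_comm]
    have h2 : L * fromRows (1 : Matrix (Fin n) (Fin n) ℂ) X = (K + L) * (fromRows (1 : Matrix (Fin n) (Fin n) ℂ) X * (1 + S)⁻¹) := by
      rw [← Matrix.mul_assoc, ← this, mul_nonsing_inv_cancel_right _ _ hS1]
    rw [Matrix.mul_assoc, h2, nonsing_inv_mul_cancel_left _ _ hKL]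
  have h2 : (K + L)⁻¹ * L * fromRows Y (1 : Matrix (Fin n) (Fin n) ℂ) = fromRows Y (1 : Matrix (Fin n) (Fin n) ℂ) * ((1 + T)⁻¹ * T) := by
    have : K * fromRows Y (1 : Matrix (Fin n) (Fin n) ℂ) * (1 + T) = (K + L) * fromRows Y (1 : Matrix (Fin n) (Fin n) ℂ) := by
      rw [Matrix.mul_add, Matrix.mul_one, ← hY, Matrix.add_mul]
    have h3 : L * fromRows Y (1 : Matrix (Fin n) (Fin n) ℂ) = (K + L) * (fromRows Y (1 : Matrix (Fin n) (Fin n) ℂ) * ((1 + T)⁻¹ * T)) := by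
      rw [← Matrix.mul_assoc, ← this, ← Matrix.mul_assoc, mul_nonsing_inv_cancel_right _ _ hT1, hY]
    rw [Matrix.mul_assoc, h3, nonsing_inv_mul_cancel_left _ _ hKL]
  set P := (1 + S)⁻¹ with hP
  set Q := (1 + T)⁻¹ * T with hQ
  have key : ∀ a, (1 - Y * X) *ᵥ a = 0 →
      a = Y *ᵥ (X *ᵥ a) ∧ P *ᵥ a = Y *ᵥ (Q *ᵥ (X *ᵥ a)) ∧ X *ᵥ (P *ᵥ a) = Q *ᵥ (X *ᵥ a) := by
    intro a ha
    rw [sub_mulVec, one_mulVec, sub_eq_zero, ← mulVec_mulVec] at ha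
    have e : fromRows (1 : Matrix (Fin n) (Fin n) ℂ) X *ᵥ a = fromRows Y (1 : Matrix (Fin n) (Fin n) ℂ) *ᵥ (X *ᵥ a) := by
      rw [fromRows_mulVec, fromRows_mulVec, one_mulVec, one_mulVec, ← ha]
    have e2 := congrArg (fun v => ((K + L)⁻¹ * L) *ᵥ v) e
    simp only [mulVec_mulVec] at e2
    rw [← Matrix.mul_assoc _ (fromRows Y (1 : Matrix (Fin n) (Fin n) ℂ)), h1, h2, ← mulVec_mulVec, Matrix.mul_assoc,
      ← mulVec_mulVec, fromRows_mulVec, fromRows_mulVec, one_mulVec, one_mulVec,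
      Sum.elim_eq_iff, ← mulVec_mulVec] at e2
    exact ⟨ha, e2.1, e2.2⟩
  by_contra hN
  obtain ⟨p, a, ha0, hNa, hPa⟩ := exists_eigenvector_of_invariant (N := 1 - Y * X) (P := P)
    (fun a ha => by
      obtain ⟨-, h3, h4⟩ := key a ha
      rw [sub_mulVec, one_mulVec, sub_eq_zero, ← mulVec_mulVec, h4, h3]) hN
  obtain ⟨ha, -, hQa⟩ := key a hNa
  rw [hPa, mulVec_smul] at hQa
  set b := X *ᵥ a with hb
  have hb0 : b ≠ 0 := fun h => ha0 (by rw [ha, h, mulVec_zero])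
  have hSa : a = p • (a + S *ᵥ a) := by
    have := congrArg (fun v => (1 + S) *ᵥ v) hPa
    simpa [mulVec_mulVec, hP, mul_nonsing_inv _ hS1, mulVec_smul, add_mulVec] using this
  have hTb : T *ᵥ b = p • (b + T *ᵥ b) := by
    have := congrArg (fun v => (1 + T) *ᵥ v) hQa
    simp only [mulVec_mulVec, hQ, mul_nonsing_inv_cancel_left _ _ hT1, mulVec_smul, add_mulVec,
      one_mulVec] at this
    exact this.symm
  have hp0 : p ≠ 0 := fun h => ha0 (by rw [hSa, h, zero_smul])
  -- A common eigenvector with eigenvalue p makes p⁻¹ - 1 an eigenvalue of S and its inverse one of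
  -- T; both cannot have modulus below 1.
  have hSe : S *ᵥ a = (p⁻¹ - 1) • a := by
    have : p⁻¹ • a = a + S *ᵥ a := by
      conv_lhs => rw [hSa]
      rw [smul_smul, inv_mul_cancel₀ hp0, one_smul]
    rw [sub_smul, one_smul, this]; abel
  have hTe : (p⁻¹ - 1) • (T *ᵥ b) = b := by
    have : p⁻¹ • (T *ᵥ b) = b + T *ᵥ b := by
      conv_lhs => rw [hTb]
      rw [smul_smul, inv_mul_cancel₀ hp0, one_smul]
    rw [sub_smul, one_smul, this]; abel
  have mem : ∀ {R : Matrix (Fin n) (Fin n) ℂ} {v : Fin n → ℂ} {μ : ℂ}, v ≠ 0 → R *ᵥ v = μ • v →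
      μ ∈ spectrum ℂ R := by
    intro R v μ hv hR
    rw [spectrum.mem_iff, ← mulVec_injective_iff_isUnit]
    intro hinj
    refine hv (hinj ?_)
    simp [sub_mulVec, hR, Algebra.algebraMap_eq_smul_one, smul_mulVec]
  have hn1 := norm_lt_one_of_mem_spectrum hS (mem ha0 hSe)
  have hl0 : p⁻¹ - 1 ≠ 0 := fun h => hb0 (by rw [← hTe, h, zero_smul])
  have hn2 := norm_lt_one_of_mem_spectrum hT (mem (μ := (p⁻¹ - 1)⁻¹) hb0 (by
    conv_rhs => rw [← hTe]
    rw [smul_smul, inv_mul_cancel₀ hl0, one_smul]))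
  rw [norm_inv] at hn2
  exact absurd hn2 (not_lt.mpr (one_le_inv_iff₀.mpr ⟨norm_pos_iff.mpr hl0, hn1.le⟩))

end Radii

end StarNARE

namespace StarNARE

/-! ### Passage from real to complex matrices -/

section Complexification

variable {m k p : Type*}

theorem toC_mul [Fintype k] (A : Matrix m k ℝ) (B : Matrix k p ℝ) :
    toC (A * B) = toC A * toC B :=
  Matrix.map_mul

theorem toC_transpose (A : Matrix m k ℝ) : toC Aᵀ = (toC A)ᵀ := rfl

theorem toC_add (A B : Matrix m k ℝ) : toC (A + B) = toC A + toC B :=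
  Matrix.map_add _ (map_add _) A B

theorem toC_sub (A B : Matrix m k ℝ) : toC (A - B) = toC A - toC B :=
  Matrix.map_sub _ (map_sub _) A B

theorem toC_neg (A : Matrix m k ℝ) : toC (-A) = -toC A := by
  ext; simp [toC]

theorem toC_zero : toC (0 : Matrix m k ℝ) = 0 := by
  ext; simp [toC]

theorem toC_one [DecidableEq m] : toC (1 : Matrix m m ℝ) = 1 :=
  Matrix.map_one _ (map_zero _) (map_one _)

theorem toC_fromBlocks {q : Type*} (A : Matrix m k ℝ) (B : Matrix m p ℝ) (C : Matrix q k ℝ)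
    (D : Matrix q p ℝ) :
    toC (fromBlocks A B C D) = fromBlocks (toC A) (toC B) (toC C) (toC D) :=
  fromBlocks_map ..

theorem toC_inv_mul_self [Fintype m] [DecidableEq m] {A : Matrix m m ℝ} (h : IsUnit A) :
    toC A⁻¹ * toC A = 1 := by
  rw [← toC_mul, nonsing_inv_mul _ ((isUnit_iff_isUnit_det _).mp h), toC_one]

end Complexification

/-! ### Invariants of the iteration and assembly -/

section Main

variable {n : ℕ} {A B C D : Matrix (Fin n) (Fin n) ℝ} {X Y K L : Matrix (Fin n) (Fin n) ℂ}

theorem linearIndependent_col_fromRows_one_left (X : Matrix (Fin n) (Fin n) ℂ) :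
    LinearIndependent ℂ (fromRows (1 : Matrix (Fin n) (Fin n) ℂ) X).col := by
  rw [← mulVec_injective_iff]
  intro a b h
  simp only [fromRows_mulVec, one_mulVec, Sum.elim_eq_iff] at h
  exact h.1

theorem linearIndependent_col_fromRows_one_right (Y : Matrix (Fin n) (Fin n) ℂ) :
    LinearIndependent ℂ (fromRows Y (1 : Matrix (Fin n) (Fin n) ℂ)).col := by
  rw [← mulVec_injective_iff]
  intro a b h
  simp only [fromRows_mulVec, one_mulVec, Sum.elim_eq_iff] at h
  exact h.2

theorem palM_mul_fromRows_left (A B C D X : Matrix (Fin n) (Fin n) ℂ) :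
    palM A B C D * fromRows (1 : Matrix (Fin n) (Fin n) ℂ) X =
      fromRows (C + D * X) (A - B * X) := by
  simp [palM, fromBlocks_mul_fromRows, sub_eq_add_neg]

theorem palM_transpose_mul_fromRows_left (A B C D X : Matrix (Fin n) (Fin n) ℂ) :
    (palM A B C D)ᵀ * fromRows (1 : Matrix (Fin n) (Fin n) ℂ) X =
      fromRows (Cᵀ + Aᵀ * X) (Dᵀ - Bᵀ * X) := by
  simp [palM, fromBlocks_transpose, fromBlocks_mul_fromRows, sub_eq_add_neg]

theorem palM_mul_fromRows_right (A B C D Y : Matrix (Fin n) (Fin n) ℂ) :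
    palM A B C D * fromRows Y (1 : Matrix (Fin n) (Fin n) ℂ) =
      fromRows (D + C * Y) (A * Y - B) := by
  simp [palM, fromBlocks_mul_fromRows, sub_eq_add_neg, add_comm]

theorem palM_transpose_mul_fromRows_right (A B C D Y : Matrix (Fin n) (Fin n) ℂ) :
    (palM A B C D)ᵀ * fromRows Y (1 : Matrix (Fin n) (Fin n) ℂ) =
      fromRows (Aᵀ + Cᵀ * Y) (Dᵀ * Y - Bᵀ) := by
  simp [palM, fromBlocks_transpose, fromBlocks_mul_fromRows, sub_eq_add_neg, add_comm]

theorem toC_palM (A B C D : Matrix (Fin n) (Fin n) ℝ) :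
    toC (palM A B C D) = palM (toC A) (toC B) (toC C) (toC D) := by
  rw [palM, toC_fromBlocks, toC_neg, palM]

/-- In block form, [E, 0; -P, I]U = [I, -G; 0, F]U L^(2^l): multiplying by S⁻¹ gives the case l = 0,
and each step squares the power of L. -/
theorem doubling_relations (hwell : DoublingWellDefined A B C D)
    (h : toC (palM A B C D) * fromRows (1 : Matrix (Fin n) (Fin n) ℂ) X =
      toC (palM A B C D)ᵀ * fromRows (1 : Matrix (Fin n) (Fin n) ℂ) X * L) (l : ℕ) :
    toC (doubling A B C D l).E = (1 - toC (doubling A B C D l).G * X) * L ^ 2 ^ l ∧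
      X - toC (doubling A B C D l).P = toC (doubling A B C D l).F * X * L ^ 2 ^ l := by
  induction l with
  | zero =>
    have h1 := congrArg (toC (palS B C D)⁻¹ * ·) h
    simp only [← Matrix.mul_assoc, ← toC_mul] at h1
    rw [inv_palS_mul_palM _ _ _ _ hwell.1, inv_palS_mul_palM_transpose _ _ _ _ hwell.1] at h1
    simp only [toC_fromBlocks, toC_zero, toC_one, toC_neg, fromBlocks_mul_fromRows,
      fromRows_mul] at h1
    obtain ⟨h2, h3⟩ := fromRows_inj h1
    simp only [Matrix.mul_one, Matrix.zero_mul, add_zero, zero_add, Matrix.one_mul,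
      Matrix.neg_mul] at h2 h3
    rw [pow_zero, pow_one]
    exact ⟨by rw [sub_eq_add_neg]; exact h2, by rw [sub_eq_neg_add]; exact h3⟩
  | succ l ih =>
    obtain ⟨hGP, hPG⟩ := hwell.2 l
    have hJ := toC_inv_mul_self hGP
    have hJ' := toC_inv_mul_self hPG
    rw [toC_sub, toC_one, toC_mul] at hJ hJ'
    have hL : L ^ 2 ^ (l + 1) = L ^ 2 ^ l * L ^ 2 ^ l := by rw [← pow_add, pow_succ, mul_two]
    rw [doubling, doublingStep]
    simp only [toC_mul, toC_add]
    rw [hL]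
    exact ⟨doubling_diag_step ih.1 ih.2 hJ, doubling_offdiag_step ih.1 ih.2 hJ'⟩

theorem doubling_dual_relations (hwell : DoublingWellDefined A B C D)
    (h : toC (palM A B C D)ᵀ * fromRows Y (1 : Matrix (Fin n) (Fin n) ℂ) =
      toC (palM A B C D) * fromRows Y (1 : Matrix (Fin n) (Fin n) ℂ) * K) (l : ℕ) :
    toC (doubling A B C D l).F = (1 - toC (doubling A B C D l).P * Y) * K ^ 2 ^ l ∧
      Y - toC (doubling A B C D l).G = toC (doubling A B C D l).E * Y * K ^ 2 ^ l := by
  induction l with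
  | zero =>
    have h1 := congrArg (toC (palS B C D)⁻¹ * ·) h
    simp only [← Matrix.mul_assoc, ← toC_mul] at h1
    rw [inv_palS_mul_palM _ _ _ _ hwell.1, inv_palS_mul_palM_transpose _ _ _ _ hwell.1] at h1
    simp only [toC_fromBlocks, toC_zero, toC_one, toC_neg, fromBlocks_mul_fromRows,
      fromRows_mul] at h1
    obtain ⟨h2, h3⟩ := fromRows_inj h1
    simp only [Matrix.mul_one, Matrix.zero_mul, add_zero, zero_add, Matrix.one_mul,
      Matrix.neg_mul] at h2 h3
    rw [pow_zero, pow_one]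
    exact ⟨by rw [sub_eq_neg_add]; exact h3, by rw [sub_eq_add_neg]; exact h2⟩
  | succ l ih =>
    obtain ⟨hGP, hPG⟩ := hwell.2 l
    have hJ := toC_inv_mul_self hPG
    have hJ' := toC_inv_mul_self hGP
    rw [toC_sub, toC_one, toC_mul] at hJ hJ'
    have hK : K ^ 2 ^ (l + 1) = K ^ 2 ^ l * K ^ 2 ^ l := by rw [← pow_add, pow_succ, mul_two]
    rw [doubling, doublingStep]
    simp only [toC_mul, toC_add]
    rw [hK]
    exact ⟨doubling_diag_step ih.1 ih.2 hJ, doubling_offdiag_step ih.1 ih.2 hJ'⟩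

theorem isUnit_of_fromRows_injective_left {R X : Matrix (Fin n) (Fin n) ℂ}
    (h : Function.Injective (fromRows (X * R) R).mulVec) : IsUnit R := by
  refine mulVec_injective_iff_isUnit.mp fun a b hab => h ?_
  rw [fromRows_mulVec, fromRows_mulVec, ← mulVec_mulVec, ← mulVec_mulVec, hab]

theorem isUnit_of_fromRows_injective_right {R X : Matrix (Fin n) (Fin n) ℂ}
    (h : Function.Injective (fromRows R (X * R)).mulVec) : IsUnit R := by
  refine mulVec_injective_iff_isUnit.mp fun a b hab => h ?_
  rw [fromRows_mulVec, fromRows_mulVec, ← mulVec_mulVec, ← mulVec_mulVec, hab]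

theorem spectralRadius_eq_of_intertwine {H : Matrix (Fin n) (Fin n) ℂ} (hH : IsUnit H)
    (h : H * K = Lᵀ * H) : spectralRadius ℂ L = spectralRadius ℂ K := by
  obtain ⟨u, rfl⟩ := hH
  have : Lᵀ = u * K * (↑u⁻¹ : Matrix (Fin n) (Fin n) ℂ) := by
    rw [h, Units.mul_inv_cancel_right]
  rw [spectralRadius, spectralRadius, ← spectrum_matrix_transpose L, this,
    spectrum.units_conjugate]

end Main

end StarNARE

theorem theorem4p1 (n : ℕ) (A B C D : Matrix (Fin n) (Fin n) ℝ)
    (X Y : Matrix (Fin n) (Fin n) ℂ)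
    (hreg : IsRegularPencil (toC (palM A B C D)) (toC (palM A B C D)ᵀ))
    (hcirc : ∀ z : ℂ, ‖z‖ = 1 →
      (toC (palM A B C D) + z • toC (palM A B C D)ᵀ).det ≠ 0)
    (hX : IsDeflatingSubspace (toC (palM A B C D)) (toC (palM A B C D)ᵀ)
      (columnSpan (fromRows 1 X)))
    (hXeig : ∀ μ : OnePoint ℂ,
      IsAssociatedEigenvalue (toC (palM A B C D)) (toC (palM A B C D)ᵀ)
        (columnSpan (fromRows 1 X)) μ → μ ∈ insideDisk)
    (hY : IsDeflatingSubspace (toC (palM A B C D)) (toC (palM A B C D)ᵀ)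
      (columnSpan (fromRows Y 1)))
    (hYeig : ∀ μ : OnePoint ℂ,
      IsAssociatedEigenvalue (toC (palM A B C D)) (toC (palM A B C D)ᵀ)
        (columnSpan (fromRows Y 1)) μ → μ ∈ outsideDisk)
    (hwell : DoublingWellDefined A B C D) :
    IsSolution (toC A) (toC B) (toC C) (toC D) X ∧
    IsDualSolution (toC A) (toC B) (toC C) (toC D) Y ∧
    IsUnit ((toC D)ᵀ - (toC B)ᵀ * X) ∧
    IsUnit (toC D + toC C * Y) ∧
    ∃ τ : ℝ≥0∞,
      τ = spectralRadius ℂ (((toC D)ᵀ - (toC B)ᵀ * X)⁻¹ * (toC A - toC B * X)) ∧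
      τ = spectralRadius ℂ ((toC D + toC C * Y)⁻¹ * ((toC A)ᵀ + (toC C)ᵀ * Y)) ∧
      τ < 1 ∧
      ∀ ν : Seminorm ℝ (Matrix (Fin n) (Fin n) ℂ), (∀ Z, ν Z = 0 → Z = 0) →
        doublingRate ν (fun l => toC (doubling A B C D l).P - X) ≤ τ ^ 2 ∧
        doublingRate ν (fun l => toC (doubling A B C D l).G - Y) ≤ τ ^ 2 ∧
        doublingRate ν (fun l => toC (doubling A B C D l).E) ≤ τ ∧
        doublingRate ν (fun l => toC (doubling A B C D l).F) ≤ τ := by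
  obtain ⟨L, hL, hMU, hUinj⟩ := hX.exists_stable_of_inside
    (linearIndependent_col_fromRows_one_left X) hXeig
  obtain ⟨K, hK, hMV, hVinj⟩ := hY.exists_stable_of_outside
    (linearIndependent_col_fromRows_one_right Y) hYeig
  have hrel := doubling_relations hwell hMU
  have hdual := doubling_dual_relations hwell hMV
  have hone : IsUnit (toC (palM A B C D) + toC (palM A B C D)ᵀ) := by
    rw [isUnit_iff_isUnit_det, isUnit_iff_ne_zero]
    simpa using hcirc 1 norm_one
  have hYX := isUnit_one_sub_mul_of_stable hone hL hK hMU hMV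
  rw [toC_transpose, toC_palM] at hMU hMV hUinj
  rw [toC_palM] at hVinj
  have hisoX := transpose_mul_mul_eq_zero_of_stable hL hMU
  have hisoY := transpose_mul_mul_eq_zero_of_stable (M := (palM (toC A) (toC B) (toC C) (toC D))ᵀ)
    hK (by rw [transpose_transpose]; exact hMV)
  -- Transposing MU = MᵀUL gives UᵀMᵀ = LᵀUᵀM, whence UᵀMVK = UᵀMᵀV = LᵀUᵀMV.
  have hHK : (fromRows (1 : Matrix (Fin n) (Fin n) ℂ) X)ᵀ * (palM (toC A) (toC B) (toC C) (toC D) *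
        fromRows Y (1 : Matrix (Fin n) (Fin n) ℂ)) * K =
      Lᵀ * ((fromRows (1 : Matrix (Fin n) (Fin n) ℂ) X)ᵀ * (palM (toC A) (toC B) (toC C) (toC D) *
        fromRows Y (1 : Matrix (Fin n) (Fin n) ℂ))) := by
    have := congrArg transpose hMU
    simp only [transpose_mul, transpose_transpose] at this
    rw [Matrix.mul_assoc, ← hMV, ← Matrix.mul_assoc, this]
    simp only [Matrix.mul_assoc]
  replace hisoY := congrArg transpose hisoY
  rw [transpose_mul, transpose_mul, transpose_transpose, transpose_transpose, Matrix.mul_assoc,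
    palM_mul_fromRows_right, transpose_fromRows, fromCols_mul_fromRows, transpose_one,
    Matrix.one_mul, transpose_zero] at hisoY
  rw [palM_mul_fromRows_left, transpose_fromRows, fromCols_mul_fromRows, transpose_one,
    Matrix.one_mul] at hisoX
  rw [palM_mul_fromRows_left, palM_transpose_mul_fromRows_left, fromRows_mul] at hMU
  rw [palM_mul_fromRows_right, palM_transpose_mul_fromRows_right, fromRows_mul] at hMV
  rw [palM_transpose_mul_fromRows_left] at hUinj
  rw [palM_mul_fromRows_right] at hVinj hHK
  have hR : IsUnit ((toC D)ᵀ - (toC B)ᵀ * X) := by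
    -- By the transposed Riccati equation the lower block of MᵀU determines the upper one, so
    -- injectivity of MᵀU passes to the lower block.
    have e : (toC C)ᵀ + (toC A)ᵀ * X = -Xᵀ * ((toC D)ᵀ - (toC B)ᵀ * X) := by
      have := congrArg transpose hisoX
      simp only [transpose_add, transpose_mul, transpose_sub, transpose_transpose,
        transpose_zero] at this
      linear_combination (norm := noncomm_ring) this
    rw [e] at hUinj
    exact isUnit_of_fromRows_injective_left hUinj
  have e : toC A * Y - toC B = -Yᵀ * (toC D + toC C * Y) := by
    linear_combination (norm := noncomm_ring) hisoY
  rw [e] at hVinj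
  have hQ : IsUnit (toC D + toC C * Y) := isUnit_of_fromRows_injective_right hVinj
  have hLeq : ((toC D)ᵀ - (toC B)ᵀ * X)⁻¹ * (toC A - toC B * X) = L := by
    rw [(fromRows_inj hMU).2, nonsing_inv_mul_cancel_left _ _ ((isUnit_iff_isUnit_det _).mp hR)]
  have hKeq : (toC D + toC C * Y)⁻¹ * ((toC A)ᵀ + (toC C)ᵀ * Y) = K := by
    rw [(fromRows_inj hMV).1, nonsing_inv_mul_cancel_left _ _ ((isUnit_iff_isUnit_det _).mp hQ)]
  have hH : (fromRows (1 : Matrix (Fin n) (Fin n) ℂ) X)ᵀ *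
      fromRows (toC D + toC C * Y) (toC A * Y - toC B) =
        (1 - Y * X)ᵀ * (toC D + toC C * Y) := by
    rw [e, transpose_fromRows, fromCols_mul_fromRows, transpose_sub, transpose_mul,
      transpose_one]
    noncomm_ring
  rw [hH] at hHK
  have hrad : spectralRadius ℂ L = spectralRadius ℂ K :=
    spectralRadius_eq_of_intertwine ((isUnit_transpose _ |>.mpr hYX).mul hQ) hHK
  refine ⟨?_, ?_, hR, hQ, spectralRadius ℂ L, by rw [hLeq], by rw [hKeq, hrad], hL, fun ν _ => ?_⟩
  · unfold IsSolution
    linear_combination (norm := noncomm_ring) hisoX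
  · unfold IsDualSolution
    linear_combination (norm := noncomm_ring) hisoY
  · obtain ⟨hE, hG⟩ := doubling_rates hK hL (fun l => (hrel l).1) (fun l => (hdual l).2) ν
    obtain ⟨hF, hP⟩ := doubling_rates hL hK (fun l => (hdual l).1) (fun l => (hrel l).2) ν
    rw [← hrad] at hF hP hG
    rw [pow_two]
    exact ⟨hP, hG, hE, hF⟩
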